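/- Let $\Omega=(0,1)$ and $I=(0,1)$, and let $V=H^1(\Omega)$, $H=L^2(\Omega)$, so that $V\subset H=H^*\subset V^*$, where $h\in H$ is identified with the functional $v\mapsto\int_\Omega hv\,dx$ on $V$. Let $\partial_t$ denote the weak derivative of $V^*$-valued functions with respect to $t\in I$, and let $$W=\{u\in L^2(I;V):\ \partial_t u\in L^2(I;V^*)\}.$$ Let $\varphi\in H^1_0(I)\setminus\{0\}$ with $\varphi\ge 0$ a.e., extended by zero to $\mathbb R$. For $n\ge 1$ put $$\varphi_n(t)=n(n+1)\,\varphi\bigl(n(n+1)t-n\bigr),\qquad \psi_n(x)=\cos(n\pi x),$$ and define $$u(x,t)=\sum_{n=1}^\infty n^{-3}\,\varphi_n(t)\,\psi_n(x)\qquad\text{for a.e. } t\in I,\ x\in\Omega.$$ Then $u$ belongs to $W$. However, the weak time derivative $\partial_t u^+$ of its positive part $u^+=\max(u,0)$ does not belong to $L^1(I;V^*)$; that is, there is no $w\in L^1(I;V^*)$ with $\int_I \eta'(t)\,u^+(t)\,dt=-\int_I\eta(t)\,w(t)\,dt$ in $V^*$ for all $\eta\in C_c^\infty(I)$. In particular $u^+\notin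 W$, so the map $u\mapsto u^+$ does not preserve $W$. -/

import Mathlib

open MeasureTheory Set Filter
open scoped ContDiff ENNReal

noncomputable section

/-- The test functions `C_c^∞(U)` on an open set `U ⊆ ℝ`. -/
structure IsTestFunction (U : Set ℝ) (η : ℝ → ℝ) : Prop where
  contDiff : ContDiff ℝ ∞ η
  hasCompactSupport : HasCompactSupport η
  tsupport_subset : tsupport η ⊆ U

/-- The Lebesgue space `L²(U)`. -/
abbrev L2 (U : Set ℝ) : Type := Lp ℝ 2 (volume.restrict U)

/-- `g` is the weak (distributional) derivative of `f` on the open set `U`. -/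
def IsWeakDeriv (U : Set ℝ) (f g : L2 U) : Prop :=
  ∀ η : ℝ → ℝ, IsTestFunction U η →
    ∫ x in U, f x * deriv η x = - ∫ x in U, g x * η x

theorem IsTestFunction.memLp {U : Set ℝ} {η : ℝ → ℝ} (h : IsTestFunction U η) :
    MemLp η 2 (volume.restrict U) :=
  (h.contDiff.continuous.memLp_of_hasCompactSupport h.hasCompactSupport).restrict U

theorem IsTestFunction.memLp_deriv {U : Set ℝ} {η : ℝ → ℝ} (h : IsTestFunction U η) :
    MemLp (deriv η) 2 (volume.restrict U) :=
  ((h.contDiff.continuous_deriv (by simp)).memLp_of_hasCompactSupport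
    h.hasCompactSupport.deriv).restrict U

theorem IsTestFunction.add {U : Set ℝ} {η θ : ℝ → ℝ} (h : IsTestFunction U η)
    (h' : IsTestFunction U θ) : IsTestFunction U (η + θ) :=
  ⟨h.contDiff.add h'.contDiff, h.hasCompactSupport.add h'.hasCompactSupport,
    (tsupport_add η θ).trans (union_subset h.tsupport_subset h'.tsupport_subset)⟩

theorem IsTestFunction.smul {U : Set ℝ} {η : ℝ → ℝ} (c : ℝ) (h : IsTestFunction U η) :
    IsTestFunction U (c • η) :=
  ⟨contDiff_const.smul h.contDiff, h.hasCompactSupport.smul_left (f := fun _ => c),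
    (closure_mono (Function.support_const_smul_subset c η)).trans h.tsupport_subset⟩

theorem isTestFunction_zero (U : Set ℝ) : IsTestFunction U 0 :=
  ⟨contDiff_const, HasCompactSupport.zero, by simp [tsupport]⟩

/-- The Sobolev space `H¹(U)`, realised as the subspace of `L²(U) × L²(U)` of all pairs `(f, f')`
with `f'` the weak derivative of `f`. The inner product inherited from the Hilbert space
`L²(U) ⊕ L²(U)` is `(f, g) ↦ ∫ f g + ∫ f' g'`. -/
def H1Submodule (U : Set ℝ) : Submodule ℝ (WithLp 2 (L2 U × L2 U)) where
  carrier := {p | IsWeakDeriv U p.fst p.snd}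
  zero_mem' := by
    intro η _
    have h0 := Lp.coeFn_zero ℝ 2 (volume.restrict U)
    have e1 : ∫ x in U, (0 : L2 U) x * deriv η x = 0 :=
      integral_eq_zero_of_ae (by filter_upwards [h0] with x hx; rw [hx]; simp)
    have e2 : ∫ x in U, (0 : L2 U) x * η x = 0 :=
      integral_eq_zero_of_ae (by filter_upwards [h0] with x hx; rw [hx]; simp)
    simp only [WithLp.zero_fst, WithLp.zero_snd]
    rw [e1, e2, neg_zero]
  add_mem' := by
    intro p q hp hq η hη
    have e1 : ∫ x in U, (p.fst + q.fst : L2 U) x * deriv η x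
        = (∫ x in U, p.fst x * deriv η x) + ∫ x in U, q.fst x * deriv η x := by
      refine Eq.trans (integral_congr_ae ?_)
        (integral_add ((Lp.memLp p.fst).integrable_mul hη.memLp_deriv)
          ((Lp.memLp q.fst).integrable_mul hη.memLp_deriv))
      filter_upwards [Lp.coeFn_add p.fst q.fst] with x hx
      simp only [hx, Pi.add_apply, add_mul]
    have e2 : ∫ x in U, (p.snd + q.snd : L2 U) x * η x
        = (∫ x in U, p.snd x * η x) + ∫ x in U, q.snd x * η x := by
      refine Eq.trans (integral_congr_ae ?_)
        (integral_add ((Lp.memLp p.snd).integrable_mul hη.memLp)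
          ((Lp.memLp q.snd).integrable_mul hη.memLp))
      filter_upwards [Lp.coeFn_add p.snd q.snd] with x hx
      simp only [hx, Pi.add_apply, add_mul]
    simp only [WithLp.add_fst, WithLp.add_snd]
    rw [e1, e2, hp η hη, hq η hη, neg_add]
  smul_mem' := by
    intro c p hp η hη
    have e1 : ∫ x in U, (c • p.fst : L2 U) x * deriv η x
        = c * ∫ x in U, p.fst x * deriv η x := by
      rw [← integral_const_mul]
      refine integral_congr_ae ?_
      filter_upwards [Lp.coeFn_smul c p.fst] with x hx
      simp [hx, mul_assoc]
    have e2 : ∫ x in U, (c • p.snd : L2 U) x * η x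
        = c * ∫ x in U, p.snd x * η x := by
      rw [← integral_const_mul]
      refine integral_congr_ae ?_
      filter_upwards [Lp.coeFn_smul c p.snd] with x hx
      simp [hx, mul_assoc]
    simp only [WithLp.smul_fst, WithLp.smul_snd]
    rw [e1, e2, hp η hη]
    ring

/-- The Sobolev space `H¹(U)`. -/
abbrev H1 (U : Set ℝ) : Type := H1Submodule U

/-- The dual space `H¹(U)*`, with the dual norm. -/
abbrev H1Dual (U : Set ℝ) : Type := StrongDual ℝ (H1 U)

/-- The embedding `H¹(U) → L²(U)`. -/
def H1.toL2 (U : Set ℝ) : H1 U →L[ℝ] L2 U :=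
  (WithLp.fstL 2 ℝ (L2 U) (L2 U)).comp (H1Submodule U).subtypeL

/-- The embedding `L²(U) = L²(U)* → H¹(U)*`, `h ↦ (v ↦ ∫ h v)`, of the evolution triple. -/
def L2.toH1Dual (U : Set ℝ) (h : L2 U) : H1Dual U :=
  (innerSL ℝ h).comp (H1.toL2 U)

/-- The test functions, as elements of `H¹(U)`. -/
def testSubmodule (U : Set ℝ) : Submodule ℝ (H1 U) where
  carrier := {v | ∃ η : ℝ → ℝ, IsTestFunction U η ∧ H1.toL2 U v =ᵐ[volume.restrict U] η}
  zero_mem' := ⟨0, isTestFunction_zero U, by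
    rw [map_zero]; exact Lp.coeFn_zero ℝ 2 (volume.restrict U)⟩
  add_mem' := by
    rintro v w ⟨η, hη, hv⟩ ⟨θ, hθ, hw⟩
    refine ⟨η + θ, hη.add hθ, ?_⟩
    rw [map_add]
    exact (Lp.coeFn_add _ _).trans (hv.add hw)
  smul_mem' := by
    rintro c v ⟨η, hη, hv⟩
    refine ⟨c • η, hη.smul c, ?_⟩
    rw [map_smul]
    exact (Lp.coeFn_smul c _).trans (hv.const_smul c)

/-- `H¹₀(U)`, the closure of `C_c^∞(U)` in `H¹(U)`. -/
def H1Zero (U : Set ℝ) : Submodule ℝ (H1 U) := (testSubmodule U).topologicalClosure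

/-- The Bochner space `L^p(I; X)`. -/
abbrev BochnerLp (I : Set ℝ) (X : Type) [NormedAddCommGroup X] (p : ℝ≥0∞) : Type :=
  Lp X p (volume.restrict I)

/-- `w` is the weak derivative with respect to time `t ∈ I`, in the sense of `H¹(U)*`-valued
distributions on `I`, of `f ∈ L²(I; L²(U))`; here `L²(U)` is embedded in `H¹(U)*`. -/
def IsWeakTimeDeriv (I U : Set ℝ) (f : BochnerLp I (L2 U) 2) (w : ℝ → H1Dual U) : Prop :=
  ∀ η : ℝ → ℝ, IsTestFunction I η →
    ∫ t in I, deriv η t • L2.toH1Dual U (f t) = - ∫ t in I, η t • w t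

/-- `∂ₜ f ∈ L^p(I; H¹(U)*)`. -/
def TimeDerivMemLp (I U : Set ℝ) (p : ℝ≥0∞) (f : BochnerLp I (L2 U) 2) : Prop :=
  ∃ w : BochnerLp I (H1Dual U) p, IsWeakTimeDeriv I U f w

/-- The embedding `L²(I; H¹(U)) → L²(I; L²(U))`, applied pointwise in time. -/
def BochnerLp.toL2 (I U : Set ℝ) (u : BochnerLp I (H1 U) 2) : BochnerLp I (L2 U) 2 :=
  (H1.toL2 U).compLp u

/-- The space `W = {u ∈ L²(I; H¹(U)) : ∂ₜ u ∈ L²(I; H¹(U)*)}`. -/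
def WSpace (I U : Set ℝ) : Set (BochnerLp I (H1 U) 2) :=
  {u | TimeDerivMemLp I U 2 (BochnerLp.toL2 I U u)}

/-- The positive part `f⁺(t, x) = max (f(t, x)) 0` of `f ∈ L²(I; L²(U))`: for a.e. `t` it is
the supremum of `f t` and `0` in the lattice `L²(U)`, i.e. the a.e. pointwise maximum. -/
def BochnerLp.positivePart (I U : Set ℝ) (f : BochnerLp I (L2 U) 2) : BochnerLp I (L2 U) 2 :=
  (lipschitzWith_sup_right (0 : L2 U)).compLp (by simp) f

/-- `φₙ(t) = n (n + 1) φ(n (n + 1) t - n)`, where `φ`, given on `(0, 1)`, is extended by zero. -/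
def phiSeq (φ : ℝ → ℝ) (n : ℕ) (t : ℝ) : ℝ :=
  n * (n + 1) * (Ioo (0 : ℝ) 1).indicator φ (n * (n + 1) * t - n)

/-- `ψₙ(x) = cos (n π x)`. -/
def psiSeq (n : ℕ) (x : ℝ) : ℝ := Real.cos (n * Real.pi * x)

end

noncomputable section

/-! ### Smooth functions and integration by parts in `H¹(0, 1)` -/

/-! The `n`-th pulse lives in the time window `(1/(n+1), 1/n)`. These windows are disjoint, so `L²`
norms in time split into sums over `n`, and nonlinear operations such as the positive part act on
one term at a time.

Membership in `W` rests on cancellation in space. Since `ψₙ` is the derivative of `sin(nπx)/(nπ)`,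
which vanishes at both end points, integration by parts against any element of `H¹` gives a dual
norm of order `1/n` (`norm_psiDual_le`). A time derivative costs a factor `n(n+1)` and a window
contributes measure of order `n⁻²`, so the squared norms of both `u` and `∂ₜu` are bounded by
multiples of `∑ n⁻²` (`memLp_train` and the two summability lemmas).

The positive part destroys the cancellation: as `φ ≥ 0`, it replaces `ψₙ` by `ψₙ⁺`, whose mean is at
least `1/4` (`quarter_le_integral_max_psiSeq`). If `w` were an integrable time derivative, testing
with the constant `1` in space and with a fixed test function rescaled to the `n`-th window would
bound the integral of `‖w‖` over that window below by a constant times `1/n`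
(`integral_deriv_mul_positivePart`). Summing over the disjoint windows would make the harmonic
series converge. -/

theorem Continuous.memLp_two_Ioo {θ : ℝ → ℝ} (h : Continuous θ) :
    MemLp θ 2 (volume.restrict (Ioo (0 : ℝ) 1)) := by
  obtain ⟨C, hC⟩ := (isCompact_Icc (a := (0 : ℝ)) (b := 1)).exists_bound_of_continuousOn
    h.continuousOn
  refine MemLp.of_bound h.aestronglyMeasurable C ?_
  filter_upwards [ae_restrict_mem measurableSet_Ioo] with x hx
  exact hC x (Ioo_subset_Icc_self hx)

theorem MeasureTheory.MemLp.inner_toLp_eq_integral {U : Set ℝ} {g : ℝ → ℝ}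
    (hg : MemLp g 2 (volume.restrict U)) (f : L2 U) :
    inner ℝ (hg.toLp g) f = ∫ x in U, f x * g x := by
  rw [L2.inner_def]
  refine integral_congr_ae ?_
  filter_upwards [hg.coeFn_toLp] with x hx
  simp [hx]

theorem IsTestFunction.integral_mul_deriv {U : Set ℝ} {θ η : ℝ → ℝ} (hη : IsTestFunction U η)
    (hθ : ContDiff ℝ ∞ θ) :
    ∫ x in U, θ x * deriv η x = -∫ x in U, deriv θ x * η x := by
  have hη' : Continuous (deriv η) := hη.contDiff.continuous_deriv (by simp)
  have hθ' : Continuous (deriv θ) := hθ.continuous_deriv (by simp)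
  have hsub := hη.tsupport_subset
  rw [setIntegral_eq_integral_of_forall_compl_eq_zero,
    setIntegral_eq_integral_of_forall_compl_eq_zero]
  · refine integral_mul_deriv_eq_deriv_mul_of_integrable
      (fun x _ => (hθ.differentiable (by simp) x).hasDerivAt)
      (fun x _ => (hη.contDiff.differentiable (by simp) x).hasDerivAt) ?_ ?_ ?_
    · exact (hθ.continuous.mul hη').integrable_of_hasCompactSupport
        hη.hasCompactSupport.deriv.mul_left
    · exact (hθ'.mul hη.contDiff.continuous).integrable_of_hasCompactSupport
        hη.hasCompactSupport.mul_left
    · exact (hθ.continuous.mul hη.contDiff.continuous).integrable_of_hasCompactSupport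
        hη.hasCompactSupport.mul_left
  · intro x hx
    rw [image_eq_zero_of_notMem_tsupport (fun h => hx (hsub h)), mul_zero]
  · intro x hx
    have : x ∉ tsupport (deriv η) := fun h => hx (hsub (tsupport_deriv_subset h))
    rw [image_eq_zero_of_notMem_tsupport this, mul_zero]

/-- The derivative `H¹(U) → L²(U)`. -/
def H1.derivL2 (U : Set ℝ) : H1 U →L[ℝ] L2 U :=
  (WithLp.sndL 2 ℝ (L2 U) (L2 U)).comp (H1Submodule U).subtypeL

theorem H1.norm_sq {U : Set ℝ} (v : H1 U) :
    ‖v‖ ^ 2 = ‖H1.toL2 U v‖ ^ 2 + ‖H1.derivL2 U v‖ ^ 2 :=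
  WithLp.prod_norm_sq_eq_of_L2 (v : WithLp 2 (L2 U × L2 U))

theorem H1.norm_derivL2_le {U : Set ℝ} (v : H1 U) : ‖H1.derivL2 U v‖ ≤ ‖v‖ :=
  abs_le_of_sq_le_sq' (by rw [H1.norm_sq]; nlinarith [sq_nonneg ‖H1.toL2 U v‖])
    (norm_nonneg v) |>.2

theorem H1.isWeakDeriv {U : Set ℝ} (v : H1 U) :
    IsWeakDeriv U (H1.toL2 U v) (H1.derivL2 U v) := v.2

/-- A smooth function on the line, restricted to `(0, 1)`, as an element of `H¹(0, 1)`. -/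
def H1.ofSmooth (θ : ℝ → ℝ) (hθ : ContDiff ℝ ∞ θ) : H1 (Ioo 0 1) :=
  ⟨WithLp.toLp 2 (hθ.continuous.memLp_two_Ioo.toLp θ,
      (hθ.continuous_deriv (by simp)).memLp_two_Ioo.toLp (deriv θ)), by
    intro η hη
    have h1 := hθ.continuous.memLp_two_Ioo.coeFn_toLp
    have h2 := (hθ.continuous_deriv (by simp)).memLp_two_Ioo.coeFn_toLp
    refine (integral_congr_ae ?_).trans ((hη.integral_mul_deriv hθ).trans
      (congrArg Neg.neg (integral_congr_ae ?_)))
    · filter_upwards [h1] with x hx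
      simp [hx]
    · filter_upwards [h2] with x hx
      simp [hx]⟩

theorem H1.toL2_ofSmooth {θ : ℝ → ℝ} (hθ : ContDiff ℝ ∞ θ) :
    H1.toL2 (Ioo 0 1) (H1.ofSmooth θ hθ) = hθ.continuous.memLp_two_Ioo.toLp θ := rfl

theorem H1.derivL2_ofSmooth {θ : ℝ → ℝ} (hθ : ContDiff ℝ ∞ θ) :
    H1.derivL2 (Ioo 0 1) (H1.ofSmooth θ hθ)
      = (hθ.continuous_deriv (by simp)).memLp_two_Ioo.toLp (deriv θ) := rfl

theorem L2.norm_le_of_bound {f : L2 (Ioo 0 1)} {C : ℝ} (hC : 0 ≤ C)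
    (h : ∀ᵐ x ∂(volume.restrict (Ioo (0 : ℝ) 1)), ‖f x‖ ≤ C) : ‖f‖ ≤ C := by
  refine (Lp.norm_le_of_ae_bound hC h).trans_eq ?_
  simp [measureUnivNNReal]

theorem H1.norm_ofSmooth_le {θ : ℝ → ℝ} (hθ : ContDiff ℝ ∞ θ) {A B : ℝ} (hA : ∀ x, |θ x| ≤ A)
    (hB : ∀ x, |deriv θ x| ≤ B) : ‖H1.ofSmooth θ hθ‖ ≤ A + B := by
  have hA0 : 0 ≤ A := (abs_nonneg _).trans (hA 0)
  have hB0 : 0 ≤ B := (abs_nonneg _).trans (hB 0)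
  have h1 : ‖H1.toL2 (Ioo 0 1) (H1.ofSmooth θ hθ)‖ ≤ A := by
    refine L2.norm_le_of_bound hA0 ?_
    rw [H1.toL2_ofSmooth]
    filter_upwards [hθ.continuous.memLp_two_Ioo.coeFn_toLp] with x hx
    rw [hx]; exact hA x
  have h2 : ‖H1.derivL2 (Ioo 0 1) (H1.ofSmooth θ hθ)‖ ≤ B := by
    refine L2.norm_le_of_bound hB0 ?_
    rw [H1.derivL2_ofSmooth]
    filter_upwards [(hθ.continuous_deriv (by simp)).memLp_two_Ioo.coeFn_toLp] with x hx
    rw [hx]; exact hB x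
  refine abs_le_of_sq_le_sq' ?_ (by positivity) |>.2
  rw [H1.norm_sq]
  nlinarith [norm_nonneg (H1.toL2 (Ioo 0 1) (H1.ofSmooth θ hθ)),
    norm_nonneg (H1.derivL2 (Ioo 0 1) (H1.ofSmooth θ hθ)), mul_nonneg hA0 hB0]

theorem L2.ae_eq_of_forall_test {U : Set ℝ} (hU : IsOpen U) {f : L2 U} {g : ℝ → ℝ}
    (hg : MemLp g 2 (volume.restrict U))
    (h : ∀ η, IsTestFunction U η → ∫ x in U, f x * η x = ∫ x in U, g x * η x) :
    f =ᵐ[volume.restrict U] g := by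
  have hloc : LocallyIntegrableOn (fun x => f x - g x) U :=
    locallyIntegrableOn_of_locallyIntegrable_restrict
      (((Lp.memLp f).sub hg).locallyIntegrable (by norm_num))
  have := hU.ae_eq_zero_of_integral_contDiff_smul_eq_zero hloc (fun η h1 h2 h3 => ?_)
  · filter_upwards [ae_restrict_of_ae this, ae_restrict_mem hU.measurableSet] with x hx hxU
    exact sub_eq_zero.1 (hx hxU)
  · have hη : IsTestFunction U η := ⟨h1, h2, h3⟩
    rw [← setIntegral_eq_integral_of_forall_compl_eq_zero (s := U)]
    · have e : ∀ x, η x • (f x - g x) = f x * η x - g x * η x := fun x => by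
        rw [smul_eq_mul]; ring
      simp_rw [e]
      refine (integral_sub ((Lp.memLp f).integrable_mul hη.memLp)
        (hg.integrable_mul hη.memLp)).trans ?_
      exact sub_eq_zero.2 (h η hη)
    · intro x hx
      rw [image_eq_zero_of_notMem_tsupport (fun h => hx (h3 h)), zero_smul]

/-- Weak derivatives are unique, and the classical derivative of a test function is one. -/
theorem H1.derivL2_ae_eq_of_test {U : Set ℝ} (hU : IsOpen U) {v : H1 U} {η : ℝ → ℝ}
    (hη : IsTestFunction U η) (hv : H1.toL2 U v =ᵐ[volume.restrict U] η) :
    H1.derivL2 U v =ᵐ[volume.restrict U] deriv η := by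
  refine L2.ae_eq_of_forall_test hU hη.memLp_deriv fun ζ hζ => ?_
  have h1 := v.isWeakDeriv ζ hζ
  have h2 := hζ.integral_mul_deriv hη.contDiff
  have h3 : ∫ x in U, H1.toL2 U v x * deriv ζ x = ∫ x in U, η x * deriv ζ x :=
    integral_congr_ae (by filter_upwards [hv] with x hx; rw [hx])
  linarith

/-- Elements of `H¹₀(0, 1)` may be integrated by parts against arbitrary smooth functions. -/
theorem H1Zero.integral_mul_deriv {φ : H1 (Ioo 0 1)} (hφ : φ ∈ H1Zero (Ioo 0 1)) {θ : ℝ → ℝ}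
    (hθ : ContDiff ℝ ∞ θ) :
    ∫ x in Ioo 0 1, H1.toL2 (Ioo 0 1) φ x * deriv θ x
      = -∫ x in Ioo 0 1, H1.derivL2 (Ioo 0 1) φ x * θ x := by
  have hm := hθ.continuous.memLp_two_Ioo
  have hm' := (hθ.continuous_deriv (by simp)).memLp_two_Ioo
  rw [← hm.inner_toLp_eq_integral, ← hm'.inner_toLp_eq_integral]
  -- Both sides are continuous in the `H¹` norm, so the identity passes from test functions to their
  -- closure.
  have hcl : IsClosed {v : H1 (Ioo 0 1) | inner ℝ (hm'.toLp (deriv θ)) (H1.toL2 (Ioo 0 1) v)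
      = -inner ℝ (hm.toLp θ) (H1.derivL2 (Ioo 0 1) v)} :=
    isClosed_eq (by fun_prop) (by fun_prop)
  refine closure_minimal ?_ hcl hφ
  rintro v ⟨η, hη, hv⟩
  have hv' := H1.derivL2_ae_eq_of_test isOpen_Ioo hη hv
  simp only [mem_ofPred_eq]
  rw [hm.inner_toLp_eq_integral, hm'.inner_toLp_eq_integral]
  have := hη.integral_mul_deriv hθ
  have e1 : ∫ x in Ioo 0 1, H1.toL2 (Ioo 0 1) v x * deriv θ x
      = ∫ x in Ioo (0 : ℝ) 1, deriv θ x * η x :=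
    integral_congr_ae (by filter_upwards [hv] with x hx; rw [hx, mul_comm])
  have e2 : ∫ x in Ioo 0 1, H1.derivL2 (Ioo 0 1) v x * θ x
      = ∫ x in Ioo (0 : ℝ) 1, θ x * deriv η x :=
    integral_congr_ae (by filter_upwards [hv'] with x hx; rw [hx, mul_comm])
  rw [e1, e2]
  linarith

/-- A nonzero element of `H¹₀(0, 1)` has a nonzero weak derivative. -/
theorem H1Zero.exists_test_integral_ne_zero {φ : H1 (Ioo 0 1)} (hφ : φ ∈ H1Zero (Ioo 0 1))
    (hne : φ ≠ 0) :
    ∃ η, IsTestFunction (Ioo 0 1) η ∧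
      ∫ x in Ioo 0 1, H1.toL2 (Ioo 0 1) φ x * deriv η x ≠ 0 := by
  by_contra! hcon
  have hd : H1.derivL2 (Ioo 0 1) φ =ᵐ[volume.restrict (Ioo (0 : ℝ) 1)] fun _ => (0 : ℝ) := by
    refine L2.ae_eq_of_forall_test isOpen_Ioo MemLp.zero' fun η hη => ?_
    have := φ.isWeakDeriv η hη
    rw [hcon η hη] at this
    simp only [zero_mul, integral_zero]
    linarith
  have h0 : H1.toL2 (Ioo 0 1) φ =ᵐ[volume.restrict (Ioo (0 : ℝ) 1)] fun _ => (0 : ℝ) := by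
    refine L2.ae_eq_of_forall_test isOpen_Ioo MemLp.zero' fun η hη => ?_
    -- Every test function is the derivative of its primitive. The primitive need not have compact
    -- support, so this is where `H¹₀` is needed: it rules out nonzero constants.
    have hder : ∀ x, HasDerivAt (fun x => ∫ t in (0 : ℝ)..x, η t) (η x) x := fun x =>
      hη.contDiff.continuous.integral_hasStrictDerivAt 0 x |>.hasDerivAt
    have hderiv : deriv (fun x => ∫ t in (0 : ℝ)..x, η t) = η := funext fun x => (hder x).deriv
    have hsm : ContDiff ℝ ∞ (fun x => ∫ t in (0 : ℝ)..x, η t) := by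
      rw [contDiff_infty_iff_deriv, hderiv]
      exact ⟨fun x => (hder x).differentiableAt, hη.contDiff⟩
    have := H1Zero.integral_mul_deriv hφ hsm
    rw [hderiv] at this
    rw [this]
    simp only [zero_mul, integral_zero, neg_eq_zero]
    refine integral_eq_zero_of_ae ?_
    filter_upwards [hd] with x hx
    simp [hx]
  apply hne
  have e1 : H1.toL2 (Ioo 0 1) φ = 0 := (Lp.eq_zero_iff_ae_eq_zero).2 h0
  have e2 : H1.derivL2 (Ioo 0 1) φ = 0 := (Lp.eq_zero_iff_ae_eq_zero).2 hd
  have := φ.norm_sq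
  rw [e1, e2] at this
  simpa using this

/-! ### Cutoff functions and integration by parts against functions vanishing at `0` and `1` -/

theorem Real.deriv_smoothTransition_of_notMem {y : ℝ} (hy : y ∉ Icc (0 : ℝ) 1) :
    deriv Real.smoothTransition y = 0 := by
  rcases lt_or_ge y 0 with h | h
  · have : Real.smoothTransition =ᶠ[nhds y] fun _ => 0 := by
      filter_upwards [Iio_mem_nhds h] with z hz
      exact Real.smoothTransition.zero_of_nonpos (le_of_lt hz)
    rw [this.deriv_eq, deriv_const]
  · have h1 : 1 < y := by
      by_contra! h1
      exact hy ⟨h, h1⟩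
    have : Real.smoothTransition =ᶠ[nhds y] fun _ => 1 := by
      filter_upwards [Ioi_mem_nhds h1] with z hz
      exact Real.smoothTransition.one_of_one_le (le_of_lt hz)
    rw [this.deriv_eq, deriv_const]

theorem Real.continuous_deriv_smoothTransition : Continuous (deriv Real.smoothTransition) :=
  (Real.smoothTransition.contDiff (n := 1)).continuous_deriv (by simp)

/-- The derivative vanishes off `1 ≤ y ≤ 2`. With `y = k * x` this makes `x` times the slope of the
cutoff bounded independently of `k`. -/
theorem Real.exists_bound_mul_deriv_smoothTransition :
    ∃ M, 0 ≤ M ∧ ∀ y : ℝ, |y * deriv Real.smoothTransition (y - 1)| ≤ M := by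
  have hc : Continuous fun y : ℝ => y * deriv Real.smoothTransition (y - 1) :=
    continuous_id.mul (Real.continuous_deriv_smoothTransition.comp (continuous_id.sub
      continuous_const))
  obtain ⟨M, hM⟩ := (isCompact_Icc (a := (1 : ℝ)) (b := 2)).exists_bound_of_continuousOn
    hc.continuousOn
  have hM0 : 0 ≤ M := (norm_nonneg _).trans (hM 1 (by norm_num))
  refine ⟨M, hM0, fun y => ?_⟩
  by_cases hy : y ∈ Icc (1 : ℝ) 2
  · exact hM y hy
  · rw [Real.deriv_smoothTransition_of_notMem, mul_zero, abs_zero]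
    · exact hM0
    · exact fun h => hy ⟨by linarith [h.1], by linarith [h.2]⟩

/-- A smooth cutoff function that vanishes outside `[1/k, 1 - 1/k]`. -/
def cutoff (k x : ℝ) : ℝ :=
  Real.smoothTransition (k * x - 1) * Real.smoothTransition (k * (1 - x) - 1)

theorem contDiff_cutoff (k : ℝ) : ContDiff ℝ ∞ (cutoff k) := by
  have h : ContDiff ℝ ∞ Real.smoothTransition := Real.smoothTransition.contDiff
  exact (h.comp (by fun_prop)).mul (h.comp (by fun_prop))

theorem abs_cutoff_le_one (k x : ℝ) : |cutoff k x| ≤ 1 := by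
  rw [cutoff, abs_of_nonneg (mul_nonneg (Real.smoothTransition.nonneg _)
    (Real.smoothTransition.nonneg _))]
  exact mul_le_one₀ (Real.smoothTransition.le_one _) (Real.smoothTransition.nonneg _)
    (Real.smoothTransition.le_one _)

theorem isTestFunction_mul_cutoff {θ : ℝ → ℝ} (hθ : ContDiff ℝ ∞ θ) {k : ℝ} (hk : 0 < k) :
    IsTestFunction (Ioo 0 1) (fun x => θ x * cutoff k x) := by
  set K : Set ℝ := {x | 1 ≤ k * x} ∩ {x | 1 ≤ k * (1 - x)} with hK
  have hKc : IsClosed K := (isClosed_le (by fun_prop) (by fun_prop)).inter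
    (isClosed_le (by fun_prop) (by fun_prop))
  have hKU : K ⊆ Ioo 0 1 := by
    rintro x ⟨h1, h2⟩
    exact ⟨pos_of_mul_pos_right (lt_of_lt_of_le one_pos h1) hk.le,
      sub_pos.1 (pos_of_mul_pos_right (lt_of_lt_of_le one_pos h2) hk.le)⟩
  have hsupp : tsupport (fun x => θ x * cutoff k x) ⊆ K := by
    refine closure_minimal (fun x hx => ?_) hKc
    by_contra hxK
    refine hx ?_
    simp only [hK, mem_inter_iff, mem_ofPred_eq, not_and_or, not_le] at hxK
    simp only [cutoff]
    rcases hxK with h | h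
    · rw [Real.smoothTransition.zero_of_nonpos (x := k * x - 1) (by linarith)]; ring
    · rw [Real.smoothTransition.zero_of_nonpos (x := k * (1 - x) - 1) (by linarith)]; ring
  refine ⟨hθ.mul (contDiff_cutoff k), ?_, hsupp.trans hKU⟩
  exact HasCompactSupport.of_support_subset_isCompact
    (isCompact_Icc.of_isClosed_subset hKc (hKU.trans Ioo_subset_Icc_self))
    (subset_closure.trans hsupp)

theorem hasDerivAt_cutoff (k x : ℝ) :
    HasDerivAt (cutoff k)
      (k * deriv Real.smoothTransition (k * x - 1) * Real.smoothTransition (k * (1 - x) - 1)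
        - Real.smoothTransition (k * x - 1)
          * (k * deriv Real.smoothTransition (k * (1 - x) - 1))) x := by
  have hs : ∀ y, HasDerivAt Real.smoothTransition (deriv Real.smoothTransition y) y := fun y =>
    ((Real.smoothTransition.contDiff (n := 1)).differentiable (by simp) y).hasDerivAt
  have h1 : HasDerivAt (fun x : ℝ => k * x - 1) k x := by
    simpa using ((hasDerivAt_id x).const_mul k).sub_const 1
  have h2 : HasDerivAt (fun x : ℝ => k * (1 - x) - 1) (-k) x := by
    simpa using (((hasDerivAt_id x).const_sub 1).const_mul k).sub_const 1
  refine (((hs (k * x - 1)).comp x h1).mul ((hs (k * (1 - x) - 1)).comp x h2)).congr_deriv ?_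
  simp only [Function.comp]
  ring

theorem eventually_cutoff_eq_one {x : ℝ} (hx : x ∈ Ioo (0 : ℝ) 1) :
    ∀ᶠ k : ℝ in atTop, cutoff k x = 1 ∧ deriv (cutoff k) x = 0 := by
  have h1 : Tendsto (fun k : ℝ => k * x) atTop atTop := tendsto_id.atTop_mul_const hx.1
  have h2 : Tendsto (fun k : ℝ => k * (1 - x)) atTop atTop :=
    tendsto_id.atTop_mul_const (sub_pos.2 hx.2)
  -- Beyond `2`, the arguments of both transitions exceed `1`, where the transition is constant.
  filter_upwards [h1.eventually_gt_atTop 2, h2.eventually_gt_atTop 2] with k hk1 hk2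
  constructor
  · rw [cutoff, Real.smoothTransition.one_of_one_le (by linarith),
      Real.smoothTransition.one_of_one_le (by linarith), one_mul]
  · rw [(hasDerivAt_cutoff k x).deriv,
      Real.deriv_smoothTransition_of_notMem fun h => by linarith [h.2],
      Real.deriv_smoothTransition_of_notMem fun h => by linarith [h.2]]
    ring

/-- The derivatives of `cutoff k`, multiplied by a function that vanishes at `0` and `1` to first
order, are bounded uniformly in `k`. -/
theorem abs_mul_deriv_cutoff_le {M L k x y : ℝ} (hL : 0 ≤ L)
    (hM : ∀ y : ℝ, |y * deriv Real.smoothTransition (y - 1)| ≤ M)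
    (hx : x ∈ Ioo (0 : ℝ) 1) (h1 : |y| ≤ L * x) (h2 : |y| ≤ L * (1 - x)) :
    |y * deriv (cutoff k) x| ≤ 2 * (L * M) := by
  have hs : ∀ z, |Real.smoothTransition z| ≤ 1 := fun z => by
    rw [abs_of_nonneg (Real.smoothTransition.nonneg _)]
    exact Real.smoothTransition.le_one _
  have key : ∀ z : ℝ, 0 < z → |y| ≤ L * z →
      |y * (k * deriv Real.smoothTransition (k * z - 1))| ≤ L * M := by
    intro z hz hy
    rw [abs_mul]
    calc |y| * |k * deriv Real.smoothTransition (k * z - 1)|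
        ≤ L * z * |k * deriv Real.smoothTransition (k * z - 1)| := by gcongr
      _ = L * |k * z * deriv Real.smoothTransition (k * z - 1)| := by
          rw [abs_mul, abs_mul, abs_mul, abs_of_pos hz]; ring
      _ ≤ L * M := by gcongr; exact hM _
  have e : y * deriv (cutoff k) x
      = y * (k * deriv Real.smoothTransition (k * x - 1))
          * Real.smoothTransition (k * (1 - x) - 1)
        - y * (k * deriv Real.smoothTransition (k * (1 - x) - 1))
          * Real.smoothTransition (k * x - 1) := by
    rw [(hasDerivAt_cutoff k x).deriv]; ring
  have hLM : 0 ≤ L * M := mul_nonneg hL ((abs_nonneg _).trans (hM 0))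
  rw [e, two_mul]
  refine (abs_sub _ _).trans (add_le_add ?_ ?_)
  · rw [abs_mul, ← mul_one (L * M)]
    exact mul_le_mul (key x hx.1 h1) (hs _) (abs_nonneg _) hLM
  · rw [abs_mul, ← mul_one (L * M)]
    exact mul_le_mul (key (1 - x) (sub_pos.2 hx.2) h2) (hs _) (abs_nonneg _) hLM

/-- The mean value inequality from each end point, with `L` a bound for the derivative on `[0, 1]`.
-/
theorem exists_abs_le_of_zero_at_endpoints {θ : ℝ → ℝ} (hθ : ContDiff ℝ ∞ θ) (h0 : θ 0 = 0)
    (h1 : θ 1 = 0) :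
    ∃ L, 0 ≤ L ∧ ∀ x ∈ Ioo (0 : ℝ) 1,
      |θ x| ≤ L ∧ |deriv θ x| ≤ L ∧ |θ x| ≤ L * x ∧ |θ x| ≤ L * (1 - x) := by
  obtain ⟨L, hL⟩ := (isCompact_Icc (a := (0 : ℝ)) (b := 1)).exists_bound_of_continuousOn
    (hθ.continuous_deriv (by simp)).continuousOn
  have hL0 : 0 ≤ L := (norm_nonneg _).trans (hL 0 (by norm_num))
  have key : ∀ a ∈ Icc (0 : ℝ) 1, ∀ b ∈ Icc (0 : ℝ) 1, ‖θ b - θ a‖ ≤ L * ‖b - a‖ :=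
    fun a ha b hb => (convex_Icc (0 : ℝ) 1).norm_image_sub_le_of_norm_deriv_le
      (fun x _ => hθ.differentiable (by simp) x) hL ha hb
  refine ⟨L, hL0, fun x hx => ?_⟩
  have hx' := Ioo_subset_Icc_self hx
  have k0 := key 0 (by norm_num) x hx'
  have k1 := key 1 (by norm_num) x hx'
  rw [h0, sub_zero, sub_zero, Real.norm_eq_abs, Real.norm_eq_abs, abs_of_pos hx.1] at k0
  rw [h1, sub_zero, Real.norm_eq_abs, Real.norm_eq_abs, abs_of_neg (sub_neg.2 hx.2), neg_sub]
    at k1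
  exact ⟨k0.trans (mul_le_of_le_one_right hL0 hx.2.le), hL x hx', k0, k1⟩

/-- Elements of `H¹(0, 1)` may be integrated by parts against smooth functions that vanish at the
end points. -/
theorem H1.integral_mul_deriv_of_zero_at_endpoints (v : H1 (Ioo 0 1)) {θ : ℝ → ℝ}
    (hθ : ContDiff ℝ ∞ θ) (h0 : θ 0 = 0) (h1 : θ 1 = 0) :
    ∫ x in Ioo 0 1, H1.toL2 (Ioo 0 1) v x * deriv θ x
      = -∫ x in Ioo 0 1, H1.derivL2 (Ioo 0 1) v x * θ x := by
  obtain ⟨M, hM0, hM⟩ := Real.exists_bound_mul_deriv_smoothTransition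
  obtain ⟨L, hL0, hL⟩ := exists_abs_le_of_zero_at_endpoints hθ h0 h1
  -- The products with cutoffs are admissible tests. The extra term `θ * deriv (cutoff k)` is
  -- bounded uniformly in `k`, as `θ` vanishes at the end points, and tends to zero pointwise;
  -- dominated convergence removes it. The shift by one keeps the cutoff parameter positive.
  have htest : ∀ k : ℕ, IsTestFunction (Ioo 0 1) (fun x => θ x * cutoff ((k : ℝ) + 1) x) :=
    fun k => isTestFunction_mul_cutoff hθ (by positivity)
  have hk : Tendsto (fun k : ℕ => (k : ℝ) + 1) atTop atTop :=
    tendsto_natCast_atTop_atTop.atTop_add tendsto_const_nhds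
  have hderiv : ∀ (k x : ℝ), deriv (fun x => θ x * cutoff k x) x
      = deriv θ x * cutoff k x + θ x * deriv (cutoff k) x := fun k x =>
    deriv_fun_mul (hθ.differentiable (by simp) x) ((contDiff_cutoff k).differentiable (by simp) x)
  have hint : ∀ f : L2 (Ioo 0 1), Integrable f (volume.restrict (Ioo (0 : ℝ) 1)) := fun f =>
    (Lp.memLp f).integrable (by norm_num)
  have t1 : Tendsto (fun k : ℕ => ∫ x in Ioo 0 1, H1.toL2 (Ioo 0 1) v x
        * deriv (fun x => θ x * cutoff ((k : ℝ) + 1) x) x) atTop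
      (nhds (∫ x in Ioo 0 1, H1.toL2 (Ioo 0 1) v x * deriv θ x)) := by
    refine tendsto_integral_of_dominated_convergence
      (fun x => ‖H1.toL2 (Ioo 0 1) v x‖ * (L + 2 * (L * M))) (fun k => ?_)
      ((hint _).norm.mul_const _) (fun k => ?_) ?_
    · exact (Lp.aestronglyMeasurable _).mul
        ((htest k).contDiff.continuous_deriv (by simp)).aestronglyMeasurable
    · filter_upwards [ae_restrict_mem measurableSet_Ioo] with x hx
      obtain ⟨-, b2, b3, b4⟩ := hL x hx
      rw [norm_mul, hderiv]
      gcongr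
      refine (norm_add_le _ _).trans (add_le_add ?_ ?_)
      · rw [norm_mul, ← mul_one L]
        exact mul_le_mul b2 (abs_cutoff_le_one _ _) (norm_nonneg _) hL0
      · exact abs_mul_deriv_cutoff_le hL0 hM hx b3 b4
    · filter_upwards [ae_restrict_mem measurableSet_Ioo] with x hx
      refine tendsto_const_nhds.congr' ?_
      filter_upwards [hk.eventually (eventually_cutoff_eq_one hx)] with k hk
      rw [hderiv, hk.1, hk.2, mul_one, mul_zero, add_zero]
  have t2 : Tendsto (fun k : ℕ => ∫ x in Ioo 0 1, H1.derivL2 (Ioo 0 1) v x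
        * (θ x * cutoff ((k : ℝ) + 1) x)) atTop
      (nhds (∫ x in Ioo 0 1, H1.derivL2 (Ioo 0 1) v x * θ x)) := by
    refine tendsto_integral_of_dominated_convergence
      (fun x => ‖H1.derivL2 (Ioo 0 1) v x‖ * L) (fun k => ?_)
      ((hint _).norm.mul_const _) (fun k => ?_) ?_
    · exact (Lp.aestronglyMeasurable _).mul (htest k).contDiff.continuous.aestronglyMeasurable
    · filter_upwards [ae_restrict_mem measurableSet_Ioo] with x hx
      obtain ⟨b1, -⟩ := hL x hx
      rw [norm_mul, norm_mul]
      gcongr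
      rw [← mul_one L]
      exact mul_le_mul b1 (abs_cutoff_le_one _ _) (norm_nonneg _) hL0
    · filter_upwards [ae_restrict_mem measurableSet_Ioo] with x hx
      refine tendsto_const_nhds.congr' ?_
      filter_upwards [hk.eventually (eventually_cutoff_eq_one hx)] with k hk
      rw [hk.1, mul_one]
  refine tendsto_nhds_unique (t1.congr fun k => ?_) t2.neg
  exact v.isWeakDeriv _ (htest k)

/-! ### The cosines `ψₙ` -/

theorem contDiff_psiSeq (n : ℕ) : ContDiff ℝ ∞ (psiSeq n) :=
  Real.contDiff_cos.comp (contDiff_const.mul contDiff_id)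

theorem hasDerivAt_psiSeq (n : ℕ) (x : ℝ) :
    HasDerivAt (psiSeq n) (-Real.sin (n * Real.pi * x) * (n * Real.pi)) x := by
  have h : HasDerivAt (fun x : ℝ => n * Real.pi * x) (n * Real.pi) x := by
    simpa using (hasDerivAt_id x).const_mul ((n : ℝ) * Real.pi)
  exact h.cos

theorem integral_psiSeq {n : ℕ} (hn : n ≠ 0) : ∫ x in (0 : ℝ)..1, psiSeq n x = 0 := by
  have hc : (n : ℝ) * Real.pi ≠ 0 := by positivity
  simp only [psiSeq]
  rw [intervalIntegral.integral_comp_mul_left (fun x => Real.cos x) hc, integral_cos]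
  simp [Real.sin_nat_mul_pi]

/-- The positive part of `ψₙ` has integral bounded away from zero. -/
theorem quarter_le_integral_max_psiSeq {n : ℕ} (hn : n ≠ 0) :
    1 / 4 ≤ ∫ x in Ioo (0 : ℝ) 1, max (psiSeq n x) 0 := by
  rw [← integral_Ioc_eq_integral_Ioo, ← intervalIntegral.integral_of_le zero_le_one]
  have hc : ∀ n, Continuous (psiSeq n) := fun n => (contDiff_psiSeq n).continuous
  -- For `|c| ≤ 1` one has `max c 0 ≥ (c + c²) / 2`. With `c = ψₙ` the double angle formula turns
  -- the right side into this integrand, whose two cosine terms have mean zero.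
  have h2 : ∫ x in (0 : ℝ)..1, (psiSeq n x / 2 + (1 / 4 + psiSeq (2 * n) x / 4)) = 1 / 4 := by
    have i1 : IntervalIntegrable (fun x => psiSeq n x / 2) volume 0 1 :=
      ((hc n).div_const 2).intervalIntegrable _ _
    have i2 : IntervalIntegrable (fun x => psiSeq (2 * n) x / 4) volume 0 1 :=
      ((hc _).div_const 4).intervalIntegrable _ _
    have z1 := integral_psiSeq hn
    have z2 := integral_psiSeq (n := 2 * n) (by lia)
    rw [intervalIntegral.integral_add i1 (intervalIntegrable_const.add i2),
      intervalIntegral.integral_add intervalIntegrable_const i2]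
    simp [intervalIntegral.integral_div, z1, z2]
  rw [← h2]
  refine intervalIntegral.integral_mono_on zero_le_one
    (((((hc n).div_const 2)).add (continuous_const.add ((hc _).div_const 4))).intervalIntegrable
      _ _) (((hc n).max continuous_const).intervalIntegrable _ _) fun x _ => ?_
  have e : psiSeq (2 * n) x = 2 * psiSeq n x ^ 2 - 1 := by
    rw [psiSeq, psiSeq, ← Real.cos_two_mul]
    push_cast
    ring_nf
  have h1 : psiSeq n x ≤ 1 := Real.cos_le_one _
  have h3 : -1 ≤ psiSeq n x := Real.neg_one_le_cos _
  rw [e]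
  rcases le_total 0 (psiSeq n x) with h | h
  · rw [max_eq_left h]; nlinarith
  · rw [max_eq_right h]; nlinarith

/-- The function `ψₙ` as an element of `H¹(0, 1)`. -/
def psiH1 (n : ℕ) : H1 (Ioo 0 1) := H1.ofSmooth (psiSeq n) (contDiff_psiSeq n)

/-- The function `ψₙ` as an element of `H¹(0, 1)*`. -/
def psiDual (n : ℕ) : H1Dual (Ioo 0 1) := L2.toH1Dual (Ioo 0 1) (H1.toL2 (Ioo 0 1) (psiH1 n))

theorem toL2_psiH1_ae (n : ℕ) :
    H1.toL2 (Ioo 0 1) (psiH1 n) =ᵐ[volume.restrict (Ioo (0 : ℝ) 1)] psiSeq n :=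
  (contDiff_psiSeq n).continuous.memLp_two_Ioo.coeFn_toLp

theorem norm_psiH1_le (n : ℕ) : ‖psiH1 n‖ ≤ 1 + n * Real.pi := by
  refine H1.norm_ofSmooth_le _ (fun x => Real.abs_cos_le_one _) fun x => ?_
  rw [(hasDerivAt_psiSeq n x).deriv, abs_mul, abs_neg, abs_of_nonneg (a := (n : ℝ) * Real.pi)
    (by positivity)]
  exact mul_le_of_le_one_left (by positivity) (Real.abs_sin_le_one _)

theorem L2.toH1Dual_apply {U : Set ℝ} (h : L2 U) (v : H1 U) :
    L2.toH1Dual U h v = inner ℝ h (H1.toL2 U v) := rfl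

theorem L2.toH1Dual_smul {U : Set ℝ} (c : ℝ) (h : L2 U) :
    L2.toH1Dual U (c • h) = c • L2.toH1Dual U h := by
  ext v
  simp [L2.toH1Dual_apply, inner_smul_left]

/-- The primitive `sin(nπx)/(nπ)` vanishes at `0` and `1`, so integrating by parts produces no
boundary term even for `v` outside `H¹₀`, and the pairing is controlled by `‖v'‖ / (nπ)`. -/
theorem norm_psiDual_le {n : ℕ} (hn : n ≠ 0) : ‖psiDual n‖ ≤ (n : ℝ)⁻¹ := by
  have hc : 0 < (n : ℝ) * Real.pi := by positivity
  refine ContinuousLinearMap.opNorm_le_bound _ (by positivity) fun v => ?_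
  set θ : ℝ → ℝ := fun x => ((n : ℝ) * Real.pi)⁻¹ * Real.sin (n * Real.pi * x) with hθdef
  have hθ : ContDiff ℝ ∞ θ :=
    contDiff_const.mul (Real.contDiff_sin.comp (contDiff_const.mul contDiff_id))
  have hθ' : deriv θ = psiSeq n := by
    funext x
    have h : HasDerivAt (fun x : ℝ => n * Real.pi * x) (n * Real.pi) x := by
      simpa using (hasDerivAt_id x).const_mul ((n : ℝ) * Real.pi)
    rw [(h.sin.const_mul ((n : ℝ) * Real.pi)⁻¹).deriv, psiSeq]
    field_simp
  have h0 : θ 0 = 0 := by simp [hθdef]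
  have h1 : θ 1 = 0 := by simp [hθdef, Real.sin_nat_mul_pi]
  have hparts := v.integral_mul_deriv_of_zero_at_endpoints hθ h0 h1
  have hm := hθ.continuous.memLp_two_Ioo
  have e : psiDual n v = -inner ℝ (hm.toLp θ) (H1.derivL2 (Ioo 0 1) v) := by
    rw [hm.inner_toLp_eq_integral, ← hparts, hθ']
    exact (contDiff_psiSeq n).continuous.memLp_two_Ioo.inner_toLp_eq_integral _
  have hb : ‖hm.toLp θ‖ ≤ (n : ℝ)⁻¹ := by
    refine L2.norm_le_of_bound (by positivity) ?_
    filter_upwards [hm.coeFn_toLp] with x hx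
    rw [hx, hθdef, norm_mul, norm_inv, Real.norm_of_nonneg hc.le]
    calc ((n : ℝ) * Real.pi)⁻¹ * ‖Real.sin (n * Real.pi * x)‖ ≤ ((n : ℝ) * Real.pi)⁻¹ * 1 := by
          gcongr; exact Real.abs_sin_le_one _
      _ ≤ (n : ℝ)⁻¹ := by
          rw [mul_one]
          gcongr
          exact le_mul_of_one_le_right (by positivity) (by linarith [Real.pi_gt_three])
  rw [e, norm_neg]
  refine (norm_inner_le_norm _ _).trans ?_
  exact mul_le_mul hb v.norm_derivL2_le (norm_nonneg _) (by positivity)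

/-! ### Trains of pulses with disjoint supports -/

/-- The pulse `t ↦ f (n (n + 1) t - n)`, supported in `(1 / (n + 1), 1 / n)`. -/
def pulse (f : ℝ → ℝ) (n : ℕ) (t : ℝ) : ℝ :=
  (Ioo (0 : ℝ) 1).indicator f (n * (n + 1) * t - n)

theorem pulse_eq_zero (f : ℝ → ℝ) {n : ℕ} {t : ℝ}
    (h : (n : ℝ) * (n + 1) * t - n ∉ Ioo (0 : ℝ) 1) : pulse f n t = 0 :=
  indicator_of_notMem h f

/-- Divide the two inequalities by `n` and `n + 1`. The index `0` has an empty window, so sums over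
`ℕ` and over positive integers agree. -/
theorem pulse_window {n : ℕ} {t : ℝ} (h : (n : ℝ) * (n + 1) * t - n ∈ Ioo (0 : ℝ) 1) :
    0 < (n : ℝ) ∧ n * t < 1 ∧ 1 < (n + 1) * t := by
  have hn : 0 < (n : ℝ) := by
    rcases Nat.eq_zero_or_pos n with rfl | h'
    · simp at h
    · exact_mod_cast h'
  obtain ⟨h1, h2⟩ := h
  exact ⟨hn, by nlinarith, by nlinarith⟩

theorem pulse_window_subset {n : ℕ} {t : ℝ} (h : (n : ℝ) * (n + 1) * t - n ∈ Ioo (0 : ℝ) 1) :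
    t ∈ Ioo (0 : ℝ) 1 := by
  obtain ⟨h0, h1, h2⟩ := pulse_window h
  have ht : 0 < t := pos_of_mul_pos_right (one_pos.trans h2) (by positivity)
  have hn : (1 : ℝ) ≤ n := by exact_mod_cast h0
  exact ⟨ht, by nlinarith⟩

theorem pulse_window_unique {m n : ℕ} {t : ℝ}
    (hm : (m : ℝ) * (m + 1) * t - m ∈ Ioo (0 : ℝ) 1)
    (hn : (n : ℝ) * (n + 1) * t - n ∈ Ioo (0 : ℝ) 1) : m = n := by
  have ht := (pulse_window_subset hm).1
  obtain ⟨-, m1, m2⟩ := pulse_window hm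
  obtain ⟨-, n1, n2⟩ := pulse_window hn
  rcases lt_trichotomy m n with h | h | h
  · have : (m : ℝ) + 1 ≤ n := by exact_mod_cast h
    nlinarith
  · exact h
  · have : (n : ℝ) + 1 ≤ m := by exact_mod_cast h
    nlinarith

/-- At any time at most one pulse is active. -/
theorem exists_pulse_index (t : ℝ) :
    ∃ n : ℕ, ∀ m : ℕ, m ≠ n → (m : ℝ) * (m + 1) * t - m ∉ Ioo (0 : ℝ) 1 := by
  by_cases h : ∃ n : ℕ, (n : ℝ) * (n + 1) * t - n ∈ Ioo (0 : ℝ) 1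
  · obtain ⟨n, hn⟩ := h
    exact ⟨n, fun m hmn hm => hmn (pulse_window_unique hm hn)⟩
  · push Not at h
    exact ⟨0, fun m _ => h m⟩

theorem measurable_pulse {f : ℝ → ℝ} (hf : Measurable f) (n : ℕ) : Measurable (pulse f n) :=
  (hf.indicator measurableSet_Ioo).comp (by fun_prop)

/-- Substitution `s = n(n+1)t - n`; the window lies in `(0, 1)`, so the integral may be taken over
the whole line. -/
theorem setIntegral_mul_pulse (ζ f : ℝ → ℝ) {n : ℕ} (hn : n ≠ 0) :
    ∫ t in Ioo (0 : ℝ) 1, ζ t * pulse f n t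
      = ((n : ℝ) * (n + 1))⁻¹ * ∫ s in Ioo (0 : ℝ) 1, ζ ((s + n) / (n * (n + 1))) * f s := by
  have hN : 0 < (n : ℝ) * (n + 1) := by positivity
  rw [setIntegral_eq_integral_of_forall_compl_eq_zero, ← integral_indicator measurableSet_Ioo]
  · have e : ∀ t, ζ t * pulse f n t = (fun r => (Ioo (0 : ℝ) 1).indicator
        (fun s => ζ ((s + n) / (n * (n + 1))) * f s) (r - n)) (n * (n + 1) * t) := fun t => by
      by_cases h : (n : ℝ) * (n + 1) * t - n ∈ Ioo (0 : ℝ) 1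
      · simp only [pulse, indicator_of_mem h]
        rw [sub_add_cancel, mul_div_cancel_left₀ _ hN.ne']
      · simp only [pulse, indicator_of_notMem h, mul_zero]
    simp_rw [e]
    rw [Measure.integral_comp_mul_left (fun r => (Ioo (0 : ℝ) 1).indicator
      (fun s => ζ ((s + n) / (n * (n + 1))) * f s) (r - n)), integral_sub_right_eq_self, smul_eq_mul,
      abs_of_pos (inv_pos.2 hN)]
  · intro t ht
    rw [pulse_eq_zero f fun h => ht (pulse_window_subset h), mul_zero]

theorem setLIntegral_enorm_pulse_sq_le {f : ℝ → ℝ} (hf : Measurable f) (n : ℕ) :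
    ∫⁻ t in Ioo (0 : ℝ) 1, ‖pulse f n t‖ₑ ^ 2
      ≤ ENNReal.ofReal ((n : ℝ) * (n + 1))⁻¹ * ∫⁻ s in Ioo (0 : ℝ) 1, ‖f s‖ₑ ^ 2 := by
  rcases Nat.eq_zero_or_pos n with rfl | hn
  · simp [pulse]
  have hN : 0 < (n : ℝ) * (n + 1) := by positivity
  refine (setLIntegral_le_lintegral _ _).trans ?_
  have e : ∀ t, ‖pulse f n t‖ₑ ^ 2 = (fun r => (Ioo (0 : ℝ) 1).indicator
        (fun s => ‖f s‖ₑ ^ 2) (r - n)) (n * (n + 1) * t) := fun t => by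
      by_cases h : (n : ℝ) * (n + 1) * t - n ∈ Ioo (0 : ℝ) 1
      · simp only [pulse, indicator_of_mem h]
      · simp only [pulse, indicator_of_notMem h, enorm_zero, ne_eq, OfNat.ofNat_ne_zero,
          not_false_eq_true, zero_pow]
  simp_rw [e]
  have hmeas : Measurable fun r : ℝ => (Ioo (0 : ℝ) 1).indicator
        (fun s => ‖f s‖ₑ ^ 2) (r - n) :=
    ((hf.enorm.pow_const 2).indicator measurableSet_Ioo).comp (by fun_prop)
  rw [← lintegral_map hmeas (measurable_const_mul _), Real.map_volume_mul_left hN.ne',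
    lintegral_smul_measure, lintegral_sub_right_eq_self (fun r => (Ioo (0 : ℝ) 1).indicator
        (fun s => ‖f s‖ₑ ^ 2) r), lintegral_indicator measurableSet_Ioo,
    abs_of_pos (inv_pos.2 hN), smul_eq_mul]

section Train

variable {E F : Type*} [NormedAddCommGroup E] [NormedSpace ℝ E] [NormedAddCommGroup F]
  [NormedSpace ℝ F]

/-- The train of pulses `∑ₙ f (n (n + 1) t - n) eₙ`. -/
def train (f : ℝ → ℝ) (e : ℕ → E) (t : ℝ) : E := ∑' n, pulse f n t • e n

theorem train_eq_of_index (f : ℝ → ℝ) (e : ℕ → E) {t : ℝ}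
    {n : ℕ} (hn : ∀ m : ℕ, m ≠ n → (m : ℝ) * (m + 1) * t - m ∉ Ioo (0 : ℝ) 1) :
    train f e t = pulse f n t • e n :=
  tsum_eq_single n fun m hm => by rw [pulse_eq_zero f (hn m hm), zero_smul]

theorem hasSum_train (f : ℝ → ℝ) (e : ℕ → E) (t : ℝ) :
    HasSum (fun n => pulse f n t • e n) (train f e t) := by
  obtain ⟨n, hn⟩ := exists_pulse_index t
  exact (summable_of_ne_finset_zero (s := {n}) fun m hm => by
    rw [pulse_eq_zero f (hn m (by simpa using hm)), zero_smul]).hasSum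

/-- Homogeneity suffices, without additivity or continuity, because at most one term is nonzero at
each time. -/
theorem map_train (L : E → F) (hL : ∀ (c : ℝ) x, L (c • x) = c • L x) (f : ℝ → ℝ) (e : ℕ → E)
    (t : ℝ) : L (train f e t) = train f (fun n => L (e n)) t := by
  obtain ⟨n, hn⟩ := exists_pulse_index t
  rw [train_eq_of_index f e hn, train_eq_of_index f _ hn, hL]

theorem aestronglyMeasurable_train {f : ℝ → ℝ} (hf : Measurable f) (e : ℕ → E)
    (μ : Measure ℝ) : AEStronglyMeasurable (train f e) μ :=
  aestronglyMeasurable_of_tendsto_ae atTop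
    (f := fun (s : Finset ℕ) t => ∑ n ∈ s, pulse f n t • e n)
    (fun s => by
      refine Finset.aestronglyMeasurable_fun_sum s fun n _ => ?_
      exact (measurable_pulse hf n).aestronglyMeasurable.smul_const (e n))
    (Eventually.of_forall fun t => hasSum_train f e t)

theorem enorm_train_sq (f : ℝ → ℝ) (e : ℕ → E) (t : ℝ) :
    ‖train f e t‖ₑ ^ 2 = ∑' n, ‖pulse f n t‖ₑ ^ 2 * ‖e n‖ₑ ^ 2 := by
  obtain ⟨n, hn⟩ := exists_pulse_index t
  rw [train_eq_of_index f e hn, enorm_smul, mul_pow, tsum_eq_single n]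
  intro m hm
  rw [pulse_eq_zero f (hn m hm)]
  simp

/-- Disjoint supports remove all cross terms; the factor `(n(n+1))⁻¹` is the Jacobian of the `n`-th
window. -/
theorem memLp_train {f : ℝ → ℝ} (hf : Measurable f)
    (hf2 : MemLp f 2 (volume.restrict (Ioo (0 : ℝ) 1))) {e : ℕ → E}
    (he : Summable fun n : ℕ => ((n : ℝ) * (n + 1))⁻¹ * ‖e n‖ ^ 2) :
    MemLp (train f e) 2 (volume.restrict (Ioo (0 : ℝ) 1)) := by
  refine ⟨aestronglyMeasurable_train hf e _, ?_⟩
  rw [eLpNorm_lt_top_iff_lintegral_rpow_enorm_lt_top two_ne_zero ENNReal.ofNat_ne_top]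
  have hK := (eLpNorm_lt_top_iff_lintegral_rpow_enorm_lt_top two_ne_zero
    ENNReal.ofNat_ne_top).1 hf2.2
  simp only [ENNReal.toReal_ofNat, ENNReal.rpow_ofNat] at hK ⊢
  simp_rw [enorm_train_sq]
  rw [lintegral_tsum fun n => (((measurable_pulse hf n).enorm.pow_const 2).mul_const _).aemeasurable]
  have hle : ∀ n : ℕ, ∫⁻ t in Ioo (0 : ℝ) 1, ‖pulse f n t‖ₑ ^ 2 * ‖e n‖ₑ ^ 2
      ≤ ENNReal.ofReal (((n : ℝ) * (n + 1))⁻¹ * ‖e n‖ ^ 2)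
        * ∫⁻ s in Ioo (0 : ℝ) 1, ‖f s‖ₑ ^ 2 := fun n => by
    rw [lintegral_mul_const _ ((measurable_pulse hf n).enorm.pow_const 2),
      ENNReal.ofReal_mul (by positivity), ENNReal.ofReal_pow (norm_nonneg _), ofReal_norm,
      mul_right_comm]
    gcongr
    exact setLIntegral_enorm_pulse_sq_le hf n
  refine (ENNReal.tsum_le_tsum hle).trans_lt ?_
  rw [ENNReal.tsum_mul_right]
  exact ENNReal.mul_lt_top he.tsum_ofReal_ne_top.lt_top hK

/-- Dominated convergence for series: by disjointness the sum of the norms of the terms is the norm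
of the integrand. -/
theorem hasSum_integral_smul_train [CompleteSpace E] {f ζ : ℝ → ℝ} (hf : Measurable f)
    (hζ : Measurable ζ) {e : ℕ → E}
    (hint : Integrable (fun t => ζ t • train f e t) (volume.restrict (Ioo (0 : ℝ) 1))) :
    HasSum (fun n => (∫ t in Ioo (0 : ℝ) 1, ζ t * pulse f n t) • e n)
      (∫ t in Ioo (0 : ℝ) 1, ζ t • train f e t) := by
  have hn : ∀ t, ∑' n, ‖(ζ t * pulse f n t) • e n‖ = ‖ζ t • train f e t‖ := fun t => by
    obtain ⟨n, hn⟩ := exists_pulse_index t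
    rw [train_eq_of_index f e hn, smul_smul, tsum_eq_single n]
    intro m hm
    rw [pulse_eq_zero f (hn m hm), mul_zero, zero_smul, norm_zero]
  have := hasSum_integral_of_dominated_convergence (μ := volume.restrict (Ioo (0 : ℝ) 1))
    (F := fun n t => (ζ t * pulse f n t) • e n) (f := fun t => ζ t • train f e t)
    (fun n t => ‖(ζ t * pulse f n t) • e n‖)
    (fun n => (hζ.mul (measurable_pulse hf n)).aestronglyMeasurable.smul_const _)
    (fun n => Eventually.of_forall fun t => le_rfl)
    (Eventually.of_forall fun t => by
      obtain ⟨n, hn⟩ := exists_pulse_index t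
      refine summable_of_ne_finset_zero (s := {n}) fun m hm => ?_
      rw [pulse_eq_zero f (hn m (by simpa using hm)), mul_zero, zero_smul, norm_zero])
    (by simp_rw [hn]; exact hint.norm)
    (Eventually.of_forall fun t => by
      simpa only [smul_smul] using (hasSum_train f e t).const_smul (ζ t))
  simpa only [integral_smul_const] using this

end Train

set_option maxSynthPendingDepth 3

/-! ### The function `u` and its time derivative -/

theorem IsTestFunction.integrable_smul {E : Type*} [NormedAddCommGroup E] [NormedSpace ℝ E]
    {U : Set ℝ} {η : ℝ → ℝ} (hη : IsTestFunction U η) {μ : Measure ℝ} {f : ℝ → E}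
    (hf : Integrable f μ) : Integrable (fun t => η t • f t) μ := by
  obtain ⟨C, hC⟩ := hη.hasCompactSupport.exists_bound_of_continuous hη.contDiff.continuous
  exact hf.bdd_smul C hη.contDiff.continuous.aestronglyMeasurable (Eventually.of_forall hC)

theorem IsTestFunction.deriv {U : Set ℝ} {η : ℝ → ℝ} (hη : IsTestFunction U η) :
    IsTestFunction U (deriv η) :=
  ⟨(contDiff_infty_iff_deriv.1 hη.contDiff).2, hη.hasCompactSupport.deriv,
    tsupport_deriv_subset.trans hη.tsupport_subset⟩

theorem L2.norm_toH1Dual_le {U : Set ℝ} (h : L2 U) : ‖L2.toH1Dual U h‖ ≤ 1 * ‖h‖ := by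
  rw [one_mul]
  refine ContinuousLinearMap.opNorm_le_bound _ (norm_nonneg _) fun v => ?_
  refine (norm_inner_le_norm (𝕜 := ℝ) h (H1.toL2 U v)).trans ?_
  gcongr
  exact abs_le_of_sq_le_sq' (by rw [H1.norm_sq v]; nlinarith [sq_nonneg ‖H1.derivL2 U v‖])
    (norm_nonneg v) |>.2

/-- The embedding `L²(U) → H¹(U)*` as a continuous linear map. -/
def L2.toH1DualL (U : Set ℝ) : L2 U →L[ℝ] H1Dual U :=
  LinearMap.mkContinuous
    { toFun := L2.toH1Dual U
      map_add' := fun f g => by ext v; simp [L2.toH1Dual_apply, inner_add_left]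
      map_smul' := L2.toH1Dual_smul } 1 L2.norm_toH1Dual_le

theorem BochnerLp.integrable_toH1Dual {U : Set ℝ} (f : BochnerLp (Ioo 0 1) (L2 U) 2) :
    Integrable (fun t => L2.toH1Dual U (f t)) (volume.restrict (Ioo (0 : ℝ) 1)) :=
  (L2.toH1DualL U).integrable_comp ((Lp.memLp f).integrable (by norm_num))

/-- The coefficients of the pulses in `u`. -/
def coeffH1 (n : ℕ) : H1 (Ioo 0 1) := ((n : ℝ) ^ (-3 : ℤ) * (n * (n + 1))) • psiH1 n

/-- The coefficients of the pulses in `∂ₜ u`. -/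
def coeffDual (n : ℕ) : H1Dual (Ioo 0 1) :=
  ((n : ℝ) ^ (-3 : ℤ) * (n * (n + 1)) ^ 2) • psiDual n

/-- Orders of magnitude: Jacobian `n⁻²`, scalar coefficient `n⁻¹`, and `‖ψₙ‖` in `H¹` at most of
order `n`. -/
theorem summable_norm_coeffH1_sq :
    Summable fun n : ℕ => ((n : ℝ) * (n + 1))⁻¹ * ‖coeffH1 n‖ ^ 2 := by
  refine Summable.of_nonneg_of_le (fun n => by positivity) (fun n => ?_)
    ((Real.summable_one_div_nat_pow.2 one_lt_two).mul_left 50)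
  rcases Nat.eq_zero_or_pos n with rfl | hn
  · simp
  have hn' : (1 : ℝ) ≤ n := by exact_mod_cast hn
  have hn0 : (0 : ℝ) < n := by positivity
  have h1 : ‖psiH1 n‖ ≤ 5 * n := by
    refine (norm_psiH1_le n).trans ?_
    nlinarith [Real.pi_lt_four]
  rw [coeffH1, norm_smul, Real.norm_of_nonneg (by positivity), zpow_neg]
  calc ((n : ℝ) * (n + 1))⁻¹ * (((n : ℝ) ^ (3 : ℤ))⁻¹ * (n * (n + 1)) * ‖psiH1 n‖) ^ 2
      ≤ ((n : ℝ) * (n + 1))⁻¹ * (((n : ℝ) ^ (3 : ℤ))⁻¹ * (n * (n + 1)) * (5 * n)) ^ 2 := by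
        gcongr
    _ = 25 * ((n : ℝ) + 1) / (n : ℝ) ^ 3 := by
        simp only [zpow_ofNat]
        field_simp
        norm_num
    _ ≤ 25 * (2 * (n : ℝ)) / (n : ℝ) ^ 3 := by gcongr; linarith
    _ = 50 * (1 / (n : ℝ) ^ 2) := by field_simp; norm_num

/-- The scalar coefficient now has order `n`, which alone would only balance the Jacobian `n⁻²`; the
dual bound `‖ψₙ‖ ≤ n⁻¹` supplies the convergence. -/
theorem summable_norm_coeffDual_sq :
    Summable fun n : ℕ => ((n : ℝ) * (n + 1))⁻¹ * ‖coeffDual n‖ ^ 2 := by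
  refine Summable.of_nonneg_of_le (fun n => by positivity) (fun n => ?_)
    ((Real.summable_one_div_nat_pow.2 one_lt_two).mul_left 8)
  rcases Nat.eq_zero_or_pos n with rfl | hn
  · simp
  have hn' : (1 : ℝ) ≤ n := by exact_mod_cast hn
  have hn0 : (0 : ℝ) < n := by positivity
  rw [coeffDual, norm_smul, Real.norm_of_nonneg (by positivity), zpow_neg]
  calc ((n : ℝ) * (n + 1))⁻¹ * (((n : ℝ) ^ (3 : ℤ))⁻¹ * (n * (n + 1)) ^ 2 * ‖psiDual n‖) ^ 2
      ≤ ((n : ℝ) * (n + 1))⁻¹ * (((n : ℝ) ^ (3 : ℤ))⁻¹ * (n * (n + 1)) ^ 2 * (n : ℝ)⁻¹) ^ 2 := by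
        gcongr
        exact norm_psiDual_le hn.ne'
    _ = ((n : ℝ) + 1) ^ 3 / (n : ℝ) ^ 5 := by
        simp only [zpow_ofNat]
        field_simp
    _ ≤ (2 * (n : ℝ)) ^ 3 / (n : ℝ) ^ 5 := by gcongr; linarith
    _ = 8 * (1 / (n : ℝ) ^ 2) := by field_simp; norm_num

theorem memLp_train_coeffH1 (f : L2 (Ioo 0 1)) :
    MemLp (train f coeffH1) 2 (volume.restrict (Ioo (0 : ℝ) 1)) :=
  memLp_train (Lp.stronglyMeasurable f).measurable (Lp.memLp f) summable_norm_coeffH1_sq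

theorem memLp_train_coeffDual (f : L2 (Ioo 0 1)) :
    MemLp (train f coeffDual) 2 (volume.restrict (Ioo (0 : ℝ) 1)) :=
  memLp_train (Lp.stronglyMeasurable f).measurable (Lp.memLp f) summable_norm_coeffDual_sq

/-- The function `u(x, t) = ∑ₙ n⁻³ φₙ(t) ψₙ(x)` as an element of `L²(I; H¹(0, 1))`. -/
def pulseSolution (φ : H1 (Ioo 0 1)) : BochnerLp (Ioo 0 1) (H1 (Ioo 0 1)) 2 :=
  (memLp_train_coeffH1 (H1.toL2 (Ioo 0 1) φ)).toLp _

theorem toL2_pulseSolution_ae (φ : H1 (Ioo 0 1)) :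
    ∀ᵐ t ∂(volume.restrict (Ioo (0 : ℝ) 1)),
      BochnerLp.toL2 (Ioo 0 1) (Ioo 0 1) (pulseSolution φ) t
        = H1.toL2 (Ioo 0 1) (train (H1.toL2 (Ioo 0 1) φ) coeffH1 t) := by
  filter_upwards [(H1.toL2 (Ioo 0 1)).coeFn_compLp (pulseSolution φ),
    (memLp_train_coeffH1 (H1.toL2 (Ioo 0 1) φ)).coeFn_toLp] with t h1 h2
  rw [BochnerLp.toL2, h1, pulseSolution, h2]

theorem hasSum_pulseSolution (φ : H1 (Ioo 0 1)) :
    ∀ᵐ t ∂(volume.restrict (Ioo (0 : ℝ) 1)), ∀ᵐ x ∂(volume.restrict (Ioo (0 : ℝ) 1)),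
      HasSum (fun n : ℕ+ => ((n : ℕ) : ℝ) ^ (-3 : ℤ)
          * phiSeq (H1.toL2 (Ioo 0 1) φ) n t * psiSeq n x)
        (H1.toL2 (Ioo 0 1) (pulseSolution φ t) x) := by
  filter_upwards [(memLp_train_coeffH1 (H1.toL2 (Ioo 0 1) φ)).coeFn_toLp] with t ht
  rw [pulseSolution, ht]
  have hz : ∀ m : ℕ, (m : ℝ) * (m + 1) * t - m ∉ Ioo (0 : ℝ) 1 →
      phiSeq (H1.toL2 (Ioo 0 1) φ) m t = 0 := fun m hm => by
    rw [phiSeq, indicator_of_notMem hm, mul_zero]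
  obtain ⟨n, hn⟩ := exists_pulse_index t
  rw [train_eq_of_index _ _ hn, coeffH1, smul_smul, map_smul]
  filter_upwards [Lp.coeFn_smul (pulse (H1.toL2 (Ioo 0 1) φ) n t
    * ((n : ℝ) ^ (-3 : ℤ) * (n * (n + 1)))) (H1.toL2 (Ioo 0 1) (psiH1 n)),
    toL2_psiH1_ae n] with x hx1 hx2
  rw [hx1, Pi.smul_apply, hx2, smul_eq_mul]
  have e : pulse (H1.toL2 (Ioo 0 1) φ) n t * ((n : ℝ) ^ (-3 : ℤ) * (n * (n + 1))) * psiSeq n x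
      = (n : ℝ) ^ (-3 : ℤ) * phiSeq (H1.toL2 (Ioo 0 1) φ) n t * psiSeq n x := by
    rw [phiSeq, pulse]; ring
  rw [e]
  -- The active index may be the dummy `0`, returned when no pulse is active; then every term of the
  -- series vanishes.
  rcases Nat.eq_zero_or_pos n with rfl | hpos
  · have h0 : phiSeq (H1.toL2 (Ioo 0 1) φ) 0 t = 0 := by simp [phiSeq]
    rw [h0, mul_zero, zero_mul]
    convert hasSum_zero using 2 with m
    rw [hz m (hn m m.pos.ne'), mul_zero, zero_mul]
  · have key : ∀ m : ℕ+, m ≠ ⟨n, hpos⟩ → ((m : ℕ) : ℝ) ^ (-3 : ℤ)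
        * phiSeq (H1.toL2 (Ioo 0 1) φ) m t * psiSeq m x = 0 := fun m hm => by
      rw [hz m (hn m fun h => hm (PNat.eq h)), mul_zero, zero_mul]
    exact hasSum_single (⟨n, hpos⟩ : ℕ+) key

/-- After rescaling to the unit interval, `η` need not vanish at the ends of the window; the
boundary terms disappear because `φ` is in `H¹₀`. -/
theorem setIntegral_deriv_mul_pulse {φ : H1 (Ioo 0 1)} (hφ : φ ∈ H1Zero (Ioo 0 1)) {η : ℝ → ℝ}
    (hη : ContDiff ℝ ∞ η) {n : ℕ} (hn : n ≠ 0) :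
    ∫ t in Ioo (0 : ℝ) 1, deriv η t * pulse (H1.toL2 (Ioo 0 1) φ) n t
      = -(n * (n + 1) * ∫ t in Ioo (0 : ℝ) 1, η t * pulse (H1.derivL2 (Ioo 0 1) φ) n t) := by
  have hN : (n : ℝ) * (n + 1) ≠ 0 := by positivity
  rw [setIntegral_mul_pulse _ _ hn, setIntegral_mul_pulse _ _ hn]
  set θ : ℝ → ℝ := fun s => η ((s + n) / (n * (n + 1))) with hθ
  have hθs : ContDiff ℝ ∞ θ := hη.comp (by fun_prop)
  have hθ' : ∀ s, deriv θ s = ((n : ℝ) * (n + 1))⁻¹ * deriv η ((s + n) / (n * (n + 1))) := by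
    intro s
    have h : HasDerivAt (fun s : ℝ => (s + n) / ((n : ℝ) * (n + 1))) ((n : ℝ) * (n + 1))⁻¹ s := by
      simpa [one_div] using ((hasDerivAt_id s).add_const (n : ℝ)).div_const ((n : ℝ) * (n + 1))
    have := ((hη.differentiable (by simp) ((s + n) / (n * (n + 1)))).hasDerivAt.comp s h).deriv
    rw [mul_comm]
    exact this
  have hp := H1Zero.integral_mul_deriv hφ hθs
  simp_rw [hθ'] at hp
  have e1 : ∫ s in Ioo (0 : ℝ) 1, H1.toL2 (Ioo 0 1) φ s
        * (((n : ℝ) * (n + 1))⁻¹ * deriv η ((s + n) / (n * (n + 1))))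
      = ((n : ℝ) * (n + 1))⁻¹ * ∫ s in Ioo (0 : ℝ) 1,
        deriv η ((s + n) / (n * (n + 1))) * H1.toL2 (Ioo 0 1) φ s := by
    rw [← integral_const_mul]
    exact integral_congr_ae (Eventually.of_forall fun s => by ring)
  have e2 : ∫ s in Ioo (0 : ℝ) 1, H1.derivL2 (Ioo 0 1) φ s * θ s
      = ∫ s in Ioo (0 : ℝ) 1, η ((s + n) / (n * (n + 1))) * H1.derivL2 (Ioo 0 1) φ s :=
    integral_congr_ae (Eventually.of_forall fun s => mul_comm _ _)
  rw [e1, e2] at hp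
  rw [hp, ← mul_assoc, mul_inv_cancel₀ hN, one_mul]

/-- The derivative is the train built from `φ'` and `coeffDual`. Both sides of the weak identity
expand into series over the pulses, which agree term by term. -/
theorem pulseSolution_mem_WSpace {φ : H1 (Ioo 0 1)} (hφ : φ ∈ H1Zero (Ioo 0 1)) :
    pulseSolution φ ∈ WSpace (Ioo 0 1) (Ioo 0 1) := by
  set w := memLp_train_coeffDual (H1.derivL2 (Ioo 0 1) φ) with hw
  refine ⟨w.toLp _, fun η hη => ?_⟩
  set L : H1 (Ioo 0 1) → H1Dual (Ioo 0 1) :=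
    fun v => L2.toH1Dual (Ioo 0 1) (H1.toL2 (Ioo 0 1) v) with hL
  have hae : (fun t => deriv η t • L2.toH1Dual (Ioo 0 1)
        (BochnerLp.toL2 (Ioo 0 1) (Ioo 0 1) (pulseSolution φ) t))
      =ᵐ[volume.restrict (Ioo (0 : ℝ) 1)] fun t => deriv η t
        • train (H1.toL2 (Ioo 0 1) φ) (fun n => L (coeffH1 n)) t := by
    filter_upwards [toL2_pulseSolution_ae φ] with t ht
    rw [ht, ← map_train L (fun c v => by simp only [hL, map_smul, L2.toH1Dual_smul])]
  have hae' : (fun t => η t • w.toLp _ t) =ᵐ[volume.restrict (Ioo (0 : ℝ) 1)]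
      fun t => η t • train (H1.derivL2 (Ioo 0 1) φ) coeffDual t := by
    filter_upwards [w.coeFn_toLp] with t ht
    rw [ht]
  have s1 := hasSum_integral_smul_train (Lp.stronglyMeasurable (H1.toL2 (Ioo 0 1) φ)).measurable
    hη.deriv.contDiff.continuous.measurable
    ((hη.deriv.integrable_smul (BochnerLp.integrable_toH1Dual _)).congr hae)
  have s2 := hasSum_integral_smul_train
    (Lp.stronglyMeasurable (H1.derivL2 (Ioo 0 1) φ)).measurable
    hη.contDiff.continuous.measurable (hη.integrable_smul (w.integrable (by norm_num)))
  rw [integral_congr_ae hae, integral_congr_ae hae']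
  refine s1.unique (s2.neg.congr_fun fun n => ?_)
  rcases Nat.eq_zero_or_pos n with rfl | hn
  · simp [pulse]
  rw [setIntegral_deriv_mul_pulse hφ hη.contDiff hn.ne']
  simp only [hL, coeffH1, coeffDual, map_smul, L2.toH1Dual_smul, psiDual, smul_smul, ← neg_smul]
  congr 1
  ring

/-! ### The positive part -/

/-- As `ψ₀ = 1`, pairing with `psiH1 0` is integration over space. -/
theorem integral_sup_zero_smul_psi (n : ℕ) {c : ℝ} (hc : 0 ≤ c) :
    L2.toH1Dual (Ioo 0 1) (c • H1.toL2 (Ioo 0 1) (psiH1 n) ⊔ 0) (psiH1 0)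
      = c * ∫ x in Ioo (0 : ℝ) 1, max (psiSeq n x) 0 := by
  rw [L2.toH1Dual_apply, real_inner_comm, ← integral_const_mul]
  refine ((contDiff_psiSeq 0).continuous.memLp_two_Ioo.inner_toLp_eq_integral _).trans
    (integral_congr_ae ?_)
  filter_upwards [Lp.coeFn_sup (c • H1.toL2 (Ioo 0 1) (psiH1 n)) 0,
    Lp.coeFn_smul c (H1.toL2 (Ioo 0 1) (psiH1 n)), Lp.coeFn_zero ℝ 2 (volume.restrict (Ioo 0 1)),
    toL2_psiH1_ae n] with x h1 h2 h3 h4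
  rw [h1, Pi.sup_apply, h2, h3, Pi.smul_apply, h4]
  simp [psiSeq, mul_max_of_nonneg _ _ hc]

/-- For positive `n` the affine change of time pulls null sets back to null sets. -/
theorem ae_pulse_nonneg {f : ℝ → ℝ}
    (hf : ∀ᵐ s ∂(volume.restrict (Ioo (0 : ℝ) 1)), 0 ≤ f s) (n : ℕ) :
    ∀ᵐ t, 0 ≤ pulse f n t := by
  rcases Nat.eq_zero_or_pos n with rfl | hn
  · simp [pulse]
  have hN : (n : ℝ) * (n + 1) ≠ 0 := by positivity
  have hq : Measure.QuasiMeasurePreserving (fun t : ℝ => (n : ℝ) * (n + 1) * t) volume volume :=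
    ⟨measurable_const_mul _, by
      rw [Real.map_volume_mul_left hN]
      exact Measure.smul_absolutelyContinuous⟩
  have hq' := (measurePreserving_sub_right (volume : Measure ℝ) (n : ℝ)).quasiMeasurePreserving
  filter_upwards [(hq'.comp hq).ae ((ae_restrict_iff' measurableSet_Ioo).1 hf)] with t ht
  exact indicator_apply_nonneg ht

theorem IsTestFunction.comp_pulse_window {η : ℝ → ℝ} (hη : IsTestFunction (Ioo 0 1) η) {n : ℕ}
    (hn : n ≠ 0) : IsTestFunction (Ioo 0 1) (fun t => η ((n : ℝ) * (n + 1) * t - n)) := by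
  have hN : (n : ℝ) * (n + 1) ≠ 0 := by positivity
  have hcont : Continuous fun s : ℝ => (s + n) / ((n : ℝ) * (n + 1)) := by fun_prop
  have hK := IsCompact.image hη.hasCompactSupport hcont
  have hsub : tsupport (fun t => η ((n : ℝ) * (n + 1) * t - n))
      ⊆ (fun s : ℝ => (s + n) / ((n : ℝ) * (n + 1))) '' tsupport η := by
    refine closure_minimal (fun t ht => ?_) hK.isClosed
    refine ⟨(n : ℝ) * (n + 1) * t - n, subset_closure ht, ?_⟩
    simp only [sub_add_cancel]
    exact mul_div_cancel_left₀ t hN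
  refine ⟨hη.contDiff.comp (by fun_prop), ?_, ?_⟩
  · exact HasCompactSupport.of_support_subset_isCompact hK (subset_closure.trans hsub)
  · refine hsub.trans ?_
    rintro _ ⟨s, hs, rfl⟩
    refine pulse_window_subset (n := n) ?_
    simp only
    rw [mul_div_cancel₀ _ hN, add_sub_cancel_right]
    exact hη.tsupport_subset hs

theorem deriv_comp_pulse_window {η : ℝ → ℝ} (hη : ContDiff ℝ ∞ η) (n : ℕ) (t : ℝ) :
    deriv (fun t => η ((n : ℝ) * (n + 1) * t - n)) t
      = n * (n + 1) * deriv η ((n : ℝ) * (n + 1) * t - n) := by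
  have h : HasDerivAt (fun t : ℝ => (n : ℝ) * (n + 1) * t - n) ((n : ℝ) * (n + 1)) t := by
    simpa using ((hasDerivAt_id t).const_mul ((n : ℝ) * (n + 1))).sub_const (n : ℝ)
  rw [mul_comm ((n : ℝ) * (n + 1)) (deriv η _)]
  exact ((hη.differentiable (by simp) ((n : ℝ) * (n + 1) * t - n)).hasDerivAt.comp t h).deriv

/-- Testing the positive part of `u` in the `n`-th pulse window, against the constant function `1`
in space. -/
theorem integral_deriv_mul_positivePart {φ : H1 (Ioo 0 1)}
    (hφ : ∀ᵐ s ∂(volume.restrict (Ioo (0 : ℝ) 1)), 0 ≤ H1.toL2 (Ioo 0 1) φ s)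
    {η : ℝ → ℝ} (hη : IsTestFunction (Ioo 0 1) η) {n : ℕ} (hn : n ≠ 0) :
    ∫ t in Ioo (0 : ℝ) 1, deriv (fun t => η ((n : ℝ) * (n + 1) * t - n)) t
        * L2.toH1Dual (Ioo 0 1) (BochnerLp.positivePart (Ioo 0 1) (Ioo 0 1)
            (BochnerLp.toL2 (Ioo 0 1) (Ioo 0 1) (pulseSolution φ)) t) (psiH1 0)
      = (n : ℝ) ^ (-3 : ℤ) * (n * (n + 1)) * (∫ x in Ioo (0 : ℝ) 1, max (psiSeq n x) 0)
        * ∫ s in Ioo (0 : ℝ) 1, H1.toL2 (Ioo 0 1) φ s * deriv η s := by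
  have hN : (n : ℝ) * (n + 1) ≠ 0 := by positivity
  set m := ∫ x in Ioo (0 : ℝ) 1, max (psiSeq n x) 0
  set c := (n : ℝ) ^ (-3 : ℤ) * (n * (n + 1)) with hc
  have hc0 : 0 ≤ c := by positivity
  have hae : ∀ᵐ t ∂(volume.restrict (Ioo (0 : ℝ) 1)),
      deriv (fun t => η ((n : ℝ) * (n + 1) * t - n)) t
        * L2.toH1Dual (Ioo 0 1) (BochnerLp.positivePart (Ioo 0 1) (Ioo 0 1)
            (BochnerLp.toL2 (Ioo 0 1) (Ioo 0 1) (pulseSolution φ)) t) (psiH1 0)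
      = c * m * (deriv (fun t => η ((n : ℝ) * (n + 1) * t - n)) t
        * pulse (H1.toL2 (Ioo 0 1) φ) n t) := by
    filter_upwards [toL2_pulseSolution_ae φ, ae_restrict_of_ae (ae_pulse_nonneg hφ n),
      LipschitzWith.coeFn_compLp (lipschitzWith_sup_right (0 : L2 (Ioo 0 1))) (by simp)
        (BochnerLp.toL2 (Ioo 0 1) (Ioo 0 1) (pulseSolution φ))] with t h1 h2 h3
    by_cases hw : (n : ℝ) * (n + 1) * t - n ∈ Ioo (0 : ℝ) 1
    · have hidx : ∀ k : ℕ, k ≠ n → (k : ℝ) * (k + 1) * t - k ∉ Ioo (0 : ℝ) 1 :=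
        fun k hk hk' => hk (pulse_window_unique hk' hw)
      rw [BochnerLp.positivePart, h3, Function.comp_apply, h1, train_eq_of_index _ _ hidx,
        coeffH1, smul_smul, map_smul, integral_sup_zero_smul_psi n (mul_nonneg h2 hc0)]
      ring
    -- Off the `n`-th window the rescaled test function vanishes, so the other pulses are not seen.
    · have hd : deriv η ((n : ℝ) * (n + 1) * t - n) = 0 :=
        image_eq_zero_of_notMem_tsupport (f := deriv η) fun h => hw (hη.deriv.tsupport_subset h)
      rw [deriv_comp_pulse_window hη.contDiff, hd]
      simp
  -- The Jacobian cancels the chain rule factor `n(n+1)`, leaving an integral independent of `n`.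
  rw [integral_congr_ae hae, integral_const_mul, setIntegral_mul_pulse _ _ hn]
  congr 1
  rw [← integral_const_mul]
  refine integral_congr_ae (Eventually.of_forall fun s => ?_)
  simp only [deriv_comp_pulse_window hη.contDiff]
  rw [mul_div_cancel₀ _ hN, add_sub_cancel_right]
  field_simp

theorem not_timeDerivMemLp_one_positivePart {φ : H1 (Ioo 0 1)} (hφ₀ : φ ∈ H1Zero (Ioo 0 1))
    (hφ_ne : φ ≠ 0)
    (hφ : ∀ᵐ s ∂(volume.restrict (Ioo (0 : ℝ) 1)), 0 ≤ H1.toL2 (Ioo 0 1) φ s) :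
    ¬ TimeDerivMemLp (Ioo 0 1) (Ioo 0 1) 1 (BochnerLp.positivePart (Ioo 0 1) (Ioo 0 1)
      (BochnerLp.toL2 (Ioo 0 1) (Ioo 0 1) (pulseSolution φ))) := by
  rintro ⟨w, hw⟩
  obtain ⟨η, hη, ha⟩ := H1Zero.exists_test_integral_ne_zero hφ₀ hφ_ne
  set a := ∫ s in Ioo (0 : ℝ) 1, H1.toL2 (Ioo 0 1) φ s * deriv η s
  obtain ⟨C, hC⟩ := hη.hasCompactSupport.exists_bound_of_continuous hη.contDiff.continuous
  have hC0 : 0 ≤ C := (norm_nonneg _).trans (hC 0)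
  have hwint : Integrable w (volume.restrict (Ioo (0 : ℝ) 1)) := (Lp.memLp w).integrable le_rfl
  set A : ℕ → Set ℝ := fun n => {t | (n : ℝ) * (n + 1) * t - n ∈ Ioo (0 : ℝ) 1} with hA
  have hAm : ∀ n, MeasurableSet (A n) := fun n =>
    measurableSet_Ioo.preimage (f := fun t : ℝ => (n : ℝ) * (n + 1) * t - n) (by fun_prop)
  -- Integrability of `w` is spent here: the disjoint windows carry summable masses.
  have hsum : Summable fun n => ∫ t in A n, ‖w t‖ ∂(volume.restrict (Ioo (0 : ℝ) 1)) :=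
    (hasSum_integral_iUnion hAm (fun i j hij => disjoint_left.2 fun t hi hj =>
      hij (pulse_window_unique hi hj)) hwint.norm.integrableOn).summable
  have key : ∀ n : ℕ, 1 / (n : ℝ) * (|a| / 4)
      ≤ C * ‖psiH1 0‖ * ∫ t in A n, ‖w t‖ ∂(volume.restrict (Ioo (0 : ℝ) 1)) := by
    intro n
    rcases Nat.eq_zero_or_pos n with rfl | hn
    · simp only [Nat.cast_zero, div_zero, zero_mul]
      exact mul_nonneg (by positivity) (integral_nonneg (fun t => norm_nonneg (w t)))
    have hn1 : (1 : ℝ) ≤ n := by exact_mod_cast hn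
    have hηn := hη.comp_pulse_window hn.ne'
    have h := congrArg (fun ℓ : H1Dual (Ioo 0 1) => ℓ (psiH1 0)) (hw _ hηn)
    simp only [neg_apply] at h
    rw [ContinuousLinearMap.integral_apply
        (hηn.deriv.integrable_smul (BochnerLp.integrable_toH1Dual
          (BochnerLp.positivePart _ _ (BochnerLp.toL2 _ _ (pulseSolution φ))))),
      ContinuousLinearMap.integral_apply (hηn.integrable_smul hwint)] at h
    simp only [smul_apply, smul_eq_mul] at h
    rw [integral_deriv_mul_positivePart hφ hη hn.ne'] at h
    set m := ∫ x in Ioo (0 : ℝ) 1, max (psiSeq n x) 0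
    have hm : 1 / 4 ≤ m := quarter_le_integral_max_psiSeq hn.ne'
    -- The right side equals `(n + 1) / n²`.
    have hcoef : 1 / (n : ℝ) ≤ (n : ℝ) ^ (-3 : ℤ) * (n * (n + 1)) := by
      rw [zpow_neg]
      norm_cast
      push_cast
      rw [div_le_iff₀ (by positivity)]
      field_simp
      linarith
    calc 1 / (n : ℝ) * (|a| / 4) = 1 / (n : ℝ) * (1 / 4) * |a| := by ring
      _ ≤ (n : ℝ) ^ (-3 : ℤ) * (n * (n + 1)) * m * |a| := by gcongr
      _ = |(n : ℝ) ^ (-3 : ℤ) * (n * (n + 1)) * m * a| := by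
          rw [abs_mul _ a, abs_of_nonneg (a := (n : ℝ) ^ (-3 : ℤ) * (n * (n + 1)) * m)]
          exact mul_nonneg (by positivity) (by linarith)
      _ ≤ C * ‖psiH1 0‖ * ∫ t in A n, ‖w t‖ ∂(volume.restrict (Ioo (0 : ℝ) 1)) := by
          rw [h, abs_neg, ← Real.norm_eq_abs, ← integral_indicator (hAm n), ← integral_const_mul]
          refine norm_integral_le_of_norm_le ((hwint.norm.indicator (hAm n)).const_mul _)
            (Eventually.of_forall fun t => ?_)
          by_cases ht : t ∈ A n
          · rw [indicator_of_mem ht, norm_mul]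
            calc _ ≤ C * (‖w t‖ * ‖psiH1 0‖) :=
                  mul_le_mul (hC _) ((w t).le_opNorm _) (norm_nonneg _) hC0
              _ = _ := by ring
          · rw [indicator_of_notMem ht, mul_zero,
              image_eq_zero_of_notMem_tsupport (f := η) fun h => ht (hη.tsupport_subset h), zero_mul,
              norm_zero]
  have hs : Summable fun n : ℕ => 1 / (n : ℝ) * (|a| / 4) :=
    Summable.of_nonneg_of_le (fun n => by positivity) key (hsum.mul_left _)
  have ha4 : |a| / 4 ≠ 0 := by positivity
  exact Real.not_summable_one_div_natCast ((summable_mul_right_iff ha4).1 hs)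

theorem TimeDerivMemLp.one_of_two {U : Set ℝ} {f : BochnerLp (Ioo 0 1) (L2 U) 2}
    (h : TimeDerivMemLp (Ioo 0 1) U 2 f) : TimeDerivMemLp (Ioo 0 1) U 1 f := by
  obtain ⟨w, hw⟩ := h
  have hm : MemLp w 1 (volume.restrict (Ioo (0 : ℝ) 1)) :=
    (Lp.memLp w).mono_exponent one_le_two
  refine ⟨hm.toLp _, fun η hη => (hw η hη).trans (congrArg Neg.neg (integral_congr_ae ?_))⟩
  filter_upwards [hm.coeFn_toLp] with t ht
  rw [ht]

end

theorem theorem2p10 (φ : H1 (Ioo 0 1)) (hφ₀ : φ ∈ H1Zero (Ioo 0 1)) (hφ_ne : φ ≠ 0)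
    (hφ_nonneg : ∀ᵐ s ∂(volume.restrict (Ioo (0 : ℝ) 1)), 0 ≤ H1.toL2 (Ioo 0 1) φ s) :
    ∃ u : BochnerLp (Ioo 0 1) (H1 (Ioo 0 1)) 2,
      (∀ᵐ t ∂(volume.restrict (Ioo (0 : ℝ) 1)), ∀ᵐ x ∂(volume.restrict (Ioo (0 : ℝ) 1)),
        HasSum (fun n : ℕ+ => ((n : ℕ) : ℝ) ^ (-3 : ℤ)
            * phiSeq (H1.toL2 (Ioo 0 1) φ) n t * psiSeq n x)
          (H1.toL2 (Ioo 0 1) (u t) x)) ∧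
      u ∈ WSpace (Ioo 0 1) (Ioo 0 1) ∧
      ¬ TimeDerivMemLp (Ioo 0 1) (Ioo 0 1) 1
          (BochnerLp.positivePart (Ioo 0 1) (Ioo 0 1) (BochnerLp.toL2 (Ioo 0 1) (Ioo 0 1) u)) ∧
      ¬ ∃ v ∈ WSpace (Ioo 0 1) (Ioo 0 1), BochnerLp.toL2 (Ioo 0 1) (Ioo 0 1) v =
          BochnerLp.positivePart (Ioo 0 1) (Ioo 0 1)
            (BochnerLp.toL2 (Ioo 0 1) (Ioo 0 1) u) := by
  have hnot := not_timeDerivMemLp_one_positivePart hφ₀ hφ_ne hφ_nonneg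
  refine ⟨pulseSolution φ, hasSum_pulseSolution φ, pulseSolution_mem_WSpace hφ₀, hnot, ?_⟩
  rintro ⟨v, hv, he⟩
  exact hnot (he ▸ TimeDerivMemLp.one_of_two hv)
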